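/- Let $\Omega=(-1,1)$, and write $\langle\cdot,\cdot\rangle$, $\|\cdot\|$ for the inner product and norm of the real space $L^2(\Omega)$. Let $a,c\in L^\infty(\Omega)$ with $a>0$ and $c\ge 0$ almost everywhere, and let $\mathcal L u=-(a u')'+c u$ with bilinear form $\mathcal B[\phi,\psi]=\int_{-1}^1 (a\phi'\psi'+c\phi\psi)\,dx$ on $\mathcal H^1_0(\Omega)$ and energy norm $\|\phi\|_{\mathcal L}=\mathcal B[\phi,\phi]^{1/2}$. Let $\mathcal R:L^2(\Omega)\to L^2(\Omega)$ be a bounded linear operator with $L^2$-adjoint $\mathcal R^*$ such that - (smoother) $\mathcal R$ and $\mathcal R^*$ map $L^2(\Omega)$ into $\mathcal H^1(\Omega)$ and $\mathcal H^1(\Omega)$ into $\mathcal H^2(\Omega)$; - (preconditioner for the Laplacian) there are constants $0<\gamma_0\le\gamma_1<\infty$ with $\gamma_0\|\phi\|^2\le\|(\mathcal R\phi)'\|^2\le\gamma_1\|\phi\|^2$ for all $\phi\in L^2(\Omega)$. Let $\mathcal W_0=\{\phi\in L^2(\Omega):\mathcal R\phi\in\mathcal H^1_0(\Omega)\}$,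 a closed subspace of $L^2(\Omega)$, let $\Pi$ be the orthogonal projection of $L^2(\Omega)$ onto $\mathcal W_0$, and let $\mathcal T=\Pi^*\mathcal R^*\mathcal L\mathcal R\Pi$, with $\mathcal L$ applied in the weak sense; that is, $\mathcal T$ is the bounded operator on $L^2(\Omega)$ with $\langle\mathcal T\phi,\psi\rangle=\mathcal B[\mathcal R\Pi\phi,\mathcal R\Pi\psi]$ for all $\phi,\psi\in L^2(\Omega)$. Put $$\kappa=\kappa_{\mathcal W_0}(\mathcal T)=\frac{\sup_{\phi\in\mathcal W_0,\ \|\phi\|=1}\mathcal B[\mathcal R\phi,\mathcal R\phi]}{\inf_{\phi\in\mathcal W_0,\ \|\phi\|=1}\mathcal B[\mathcal R\phi,\mathcal R\phi]}\in[1,\infty].$$ Let $f\in L^2(\Omega)$ with $\mathcal R^*f\in\mathcal W_0$, and let $u$ be the solution of $\mathcal L u=f$ on $\Omega$, $u(\pm1)=0$, that is, $u\in\mathcal H^1_0(\Omega)$ and $\mathcal B[u,\psi]=\langle f,\psi\rangle$ for all $\psi\in\mathcal H^1_0(\Omega)$. Assume that $u=\mathcal R v$ for some $v\in L^2(\Omega)$.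 Let $u_k=\mathcal R v_k$ be the iterates of the preconditioned CG method: $v_0=0$, $r_0=p_0=\mathcal R^*f$ and, for $k\ge0$, $$\alpha_k=\frac{\langle r_k,r_k\rangle}{\mathcal B[\mathcal R p_k,\mathcal R p_k]},\quad v_{k+1}=v_k+\alpha_kp_k,\quad r_{k+1}=r_k-\alpha_k\mathcal T p_k,\quad \beta_k=\frac{\langle r_{k+1},r_{k+1}\rangle}{\langle r_k,r_k\rangle},\quad p_{k+1}=r_{k+1}+\beta_kp_k,$$ where the iterates stay constant once $r_k=0$. Then $$\|u-u_k\|_{\mathcal L}\le 2\left(\frac{\sqrt{\kappa}-1}{\sqrt{\kappa}+1}\right)^k\|u\|_{\mathcal L},\qquad k\ge0,$$ where the fraction is read as its limit $1$ if $\kappa=\infty$. If moreover $a$ is bounded below by a positive constant almost everywhere, then $1\le\kappa<\infty$, so that the fraction lies in $[0,1)$ and the iterates converge geometrically to $u$ in the energy norm. -/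

import Mathlib

open MeasureTheory Filter Topology
open scoped ENNReal ContDiff InnerProductSpace

noncomputable section

namespace OperatorCG

/-! ### Function spaces on the interval (-1, 1) -/

/-- The domain `Ω = (-1, 1)`. -/
abbrev Ω : Set ℝ := Set.Ioo (-1) 1

/-- Lebesgue measure on `Ω`. -/
abbrev μΩ : Measure ℝ := volume.restrict Ω

/-- The real Hilbert space `L²(Ω)`. -/
abbrev L2 := Lp ℝ 2 μΩ

/-- The space `L^∞(Ω)`. -/
abbrev Linf := Lp ℝ ∞ μΩ

/-- Smooth functions with compact support inside `Ω`. -/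
def IsTest (η : ℝ → ℝ) : Prop :=
  ContDiff ℝ ∞ η ∧ HasCompactSupport η ∧ tsupport η ⊆ Ω

/-- `g` is the weak derivative of `u` on `Ω`. -/
def IsWeakDeriv (u g : L2) : Prop :=
  ∀ η : ℝ → ℝ, IsTest η → ∫ x in Ω, u x * deriv η x = - ∫ x in Ω, g x * η x

theorem IsTest.memLp {η : ℝ → ℝ} (h : IsTest η) : MemLp η 2 μΩ :=
  (h.1.continuous.memLp_of_hasCompactSupport h.2.1).restrict _

theorem IsTest.deriv_memLp {η : ℝ → ℝ} (h : IsTest η) : MemLp (deriv η) 2 μΩ :=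
  ((h.1.continuous_deriv (by simp)).memLp_of_hasCompactSupport h.2.1.deriv).restrict _

theorem L2.integrable_mul (u : L2) {η : ℝ → ℝ} (h : MemLp η 2 μΩ) :
    Integrable (fun x => u x * η x) μΩ :=
  (Lp.memLp u).integrable_mul h

theorem IsWeakDeriv.unique {u g h : L2} (hg : IsWeakDeriv u g) (hh : IsWeakDeriv u h) :
    g = h := by
  have hL : LocallyIntegrableOn (fun x => g x - h x) Ω volume := by
    have h1 : Integrable (fun x => g x - h x) μΩ :=
      ((Lp.memLp g).sub (Lp.memLp h)).integrable (by norm_num)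
    exact IntegrableOn.locallyIntegrableOn h1
  have key := isOpen_Ioo.ae_eq_zero_of_integral_contDiff_smul_eq_zero (U := Ω) hL (by
    intro η h1 h2 h3
    have ht : IsTest η := ⟨h1, h2, h3⟩
    have e : ∫ x in Ω, (g x * η x - h x * η x) = 0 := by
      rw [integral_sub (L2.integrable_mul g ht.memLp) (L2.integrable_mul h ht.memLp)]
      have := hg η ht
      have := hh η ht
      linarith
    rw [← e, ← setIntegral_eq_integral_of_forall_compl_eq_zero (s := Ω)]
    · refine integral_congr_ae (Eventually.of_forall fun x => ?_)
      simp only [smul_eq_mul]; ring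
    · intro x hx
      have : η x = 0 := image_eq_zero_of_notMem_tsupport fun hx' => hx (h3 hx')
      simp [this])
  refine Lp.ext ?_
  rw [Filter.EventuallyEq, ae_restrict_iff' measurableSet_Ioo]
  filter_upwards [key] with x hx hxΩ
  exact sub_eq_zero.1 (hx hxΩ)

theorem IsWeakDeriv.zero : IsWeakDeriv 0 0 := by
  intro η _
  have h0 : ((0 : L2) : ℝ → ℝ) =ᵐ[μΩ] 0 := Lp.coeFn_zero ..
  have key (ζ : ℝ → ℝ) : ∫ x in Ω, ((0 : L2) : ℝ → ℝ) x * ζ x = 0 := by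
    refine integral_eq_zero_of_ae ?_
    filter_upwards [h0] with x hx
    rw [hx, Pi.zero_apply, zero_mul]
  rw [key, key, neg_zero]

theorem IsWeakDeriv.add {u g v h : L2} (hg : IsWeakDeriv u g) (hh : IsWeakDeriv v h) :
    IsWeakDeriv (u + v) (g + h) := by
  have key (p q : L2) (η : ℝ → ℝ) (hη : MemLp η 2 μΩ) :
      ∫ x in Ω, (p + q : L2) x * η x = (∫ x in Ω, p x * η x) + ∫ x in Ω, q x * η x := by
    rw [← integral_add (L2.integrable_mul p hη) (L2.integrable_mul q hη)]
    refine integral_congr_ae ?_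
    filter_upwards [Lp.coeFn_add p q] with x hx
    rw [hx, Pi.add_apply]; ring
  intro η hη
  rw [key _ _ _ hη.deriv_memLp, key _ _ _ hη.memLp, hg η hη, hh η hη]; ring

theorem IsWeakDeriv.smul {u g : L2} (t : ℝ) (hg : IsWeakDeriv u g) :
    IsWeakDeriv (t • u) (t • g) := by
  have key (p : L2) (η : ℝ → ℝ) :
      ∫ x in Ω, (t • p : L2) x * η x = t * ∫ x in Ω, p x * η x := by
    rw [← integral_const_mul]
    refine integral_congr_ae ?_
    filter_upwards [Lp.coeFn_smul t p] with x hx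
    rw [hx, Pi.smul_apply, smul_eq_mul]; ring
  intro η hη
  rw [key, key, hg η hη]; ring

/-- The Sobolev space `H¹(Ω)`. -/
def H1 : Submodule ℝ L2 where
  carrier := {u | ∃ g, IsWeakDeriv u g}
  zero_mem' := ⟨0, IsWeakDeriv.zero⟩
  add_mem' := fun ⟨g, hg⟩ ⟨h, hh⟩ => ⟨g + h, hg.add hh⟩
  smul_mem' := fun t _ ⟨g, hg⟩ => ⟨t • g, hg.smul t⟩

open Classical in
/-- The weak derivative `u'` of `u ∈ H¹(Ω)` (and `0` if `u ∉ H¹(Ω)`). -/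
def weakDeriv (u : L2) : L2 := if h : ∃ g, IsWeakDeriv u g then h.choose else 0

theorem isWeakDeriv_weakDeriv {u : L2} (h : u ∈ H1) : IsWeakDeriv u (weakDeriv u) := by
  have h' : ∃ g, IsWeakDeriv u g := h
  rw [weakDeriv, dif_pos h']
  exact h'.choose_spec

theorem IsWeakDeriv.weakDeriv_eq {u g : L2} (h : IsWeakDeriv u g) : weakDeriv u = g :=
  (isWeakDeriv_weakDeriv ⟨g, h⟩).unique h

/-- The Sobolev space `H²(Ω)`, as a subset of `L²(Ω)`. -/
def H2 : Set L2 := {u | u ∈ H1 ∧ weakDeriv u ∈ H1}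

/-- The pairs `(η, η')` in `L² × L²` with `η` a test function. -/
def testGraph : Submodule ℝ (L2 × L2) where
  carrier := {P | ∃ η : ℝ → ℝ, IsTest η ∧ P.1 =ᵐ[μΩ] η ∧ P.2 =ᵐ[μΩ] deriv η}
  zero_mem' := by
    refine ⟨0, ⟨contDiff_const, HasCompactSupport.zero, by simp⟩, Lp.coeFn_zero .., ?_⟩
    have : deriv (0 : ℝ → ℝ) = 0 := by ext x; simp
    rw [this]; exact Lp.coeFn_zero ..
  add_mem' := by
    rintro P Q ⟨η, hη, h1, h2⟩ ⟨ζ, hζ, k1, k2⟩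
    refine ⟨η + ζ, ⟨hη.1.add hζ.1, hη.2.1.add hζ.2.1, ?_⟩, ?_, ?_⟩
    · exact (tsupport_add η ζ).trans (Set.union_subset hη.2.2 hζ.2.2)
    · exact (Lp.coeFn_add _ _).trans (h1.add k1)
    · have : deriv (η + ζ) = deriv η + deriv ζ := by
        ext x
        exact deriv_add (hη.1.differentiable (by simp) x) (hζ.1.differentiable (by simp) x)
      rw [this]
      exact (Lp.coeFn_add _ _).trans (h2.add k2)
  smul_mem' := by
    rintro t P ⟨η, hη, h1, h2⟩
    refine ⟨t • η, ⟨hη.1.const_smul t, hη.2.1.smul_left, ?_⟩, ?_, ?_⟩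
    · exact (closure_mono (Function.support_const_smul_subset t η)).trans hη.2.2
    · exact (Lp.coeFn_smul _ _).trans (h1.const_smul t)
    · have : deriv (t • η) = t • deriv η := by
        ext x
        exact deriv_const_smul t (hη.1.differentiable (by simp) x)
      rw [this]
      exact (Lp.coeFn_smul _ _).trans (h2.const_smul t)

/-- The Sobolev space `H¹₀(Ω)`: the closure of the test functions in the `H¹` norm. -/
def H10 : Submodule ℝ L2 where
  carrier := {u | u ∈ H1 ∧ (u, weakDeriv u) ∈ testGraph.topologicalClosure}
  zero_mem' := by
    refine ⟨H1.zero_mem, ?_⟩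
    rw [IsWeakDeriv.zero.weakDeriv_eq]
    exact Submodule.zero_mem _
  add_mem' := by
    rintro u v ⟨hu, hu'⟩ ⟨hv, hv'⟩
    refine ⟨H1.add_mem hu hv, ?_⟩
    rw [((isWeakDeriv_weakDeriv hu).add (isWeakDeriv_weakDeriv hv)).weakDeriv_eq]
    exact Submodule.add_mem _ hu' hv'
  smul_mem' := by
    rintro t u ⟨hu, hu'⟩
    refine ⟨H1.smul_mem t hu, ?_⟩
    rw [((isWeakDeriv_weakDeriv hu).smul t).weakDeriv_eq]
    exact Submodule.smul_mem _ t hu'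

/-! ### The differential operator `ℒu = -(a u')' + c u` -/

/-- The bilinear form `ℬ[u, w] = ∫ a u' w' + c u w` associated with `ℒ`. -/
def bform (a c : Linf) (u w : L2) : ℝ :=
  ∫ x in Ω, (a x * weakDeriv u x * weakDeriv w x + c x * u x * w x)

/-- The energy norm `‖u‖_ℒ = ℬ[u, u]^{1/2}`. -/
def energyNorm (a c : Linf) (u : L2) : ℝ := √(bform a c u u)

/-- `u` is the (weak) solution of `ℒu = f` on `Ω`, `u(±1) = 0`. -/
def IsSolution (a c : Linf) (f u : L2) : Prop :=
  u ∈ H10 ∧ ∀ w ∈ H10, bform a c u w = ⟪f, w⟫_ℝ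

/-- Multiplication by an `L^∞` function, as a bounded operator on `L²(Ω)`. -/
def mulOp (a : Linf) : L2 →L[ℝ] L2 := (ContinuousLinearMap.mul ℝ ℝ).holderL μΩ ∞ 2 2 a

theorem mulOp_coeFn (a : Linf) (u : L2) : mulOp a u =ᵐ[μΩ] fun x => a x * u x :=
  (ContinuousLinearMap.mul ℝ ℝ).coeFn_holder (r := 2) a u

theorem bform_eq (a c : Linf) (u w : L2) :
    bform a c u w =
      ⟪mulOp a (weakDeriv u), weakDeriv w⟫_ℝ + ⟪mulOp c u, w⟫_ℝ := by
  have key (a : Linf) (u w : L2) :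
      ⟪mulOp a u, w⟫_ℝ = ∫ x in Ω, a x * u x * w x ∧
        Integrable (fun x => a x * u x * w x) μΩ := by
    have e : (fun x => a x * u x * w x) =ᵐ[μΩ] fun x => mulOp a u x * w x := by
      filter_upwards [mulOp_coeFn a u] with x hx
      rw [hx]
    refine ⟨?_, (L2.integrable_mul _ (Lp.memLp w)).congr e.symm⟩
    rw [L2.inner_def, integral_congr_ae e]
    refine integral_congr_ae (Eventually.of_forall fun x => ?_)
    simp [mul_comm]
  rw [bform, integral_add (key a _ _).2 (key c _ _).2, (key a _ _).1, (key c _ _).1]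

/-! ### Operator preconditioners -/

/-- An operator preconditioner: a bounded linear operator on `L²(Ω)` that is, together with its
`L²` adjoint, a smoother, and that is a preconditioner for the Laplacian. -/
structure Preconditioner where
  /-- the bounded linear operator itself -/
  R : L2 →L[ℝ] L2
  map_L2 : ∀ φ, R φ ∈ H1
  map_H1 : ∀ φ ∈ H1, R φ ∈ H2
  adjoint_map_L2 : ∀ φ, ContinuousLinearMap.adjoint R φ ∈ H1
  adjoint_map_H1 : ∀ φ ∈ H1, ContinuousLinearMap.adjoint R φ ∈ H2
  laplacian : ∃ γ₀ γ₁ : ℝ, 0 < γ₀ ∧ γ₀ ≤ γ₁ ∧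
    ∀ φ, γ₀ * ‖φ‖ ^ 2 ≤ ‖weakDeriv (R φ)‖ ^ 2 ∧ ‖weakDeriv (R φ)‖ ^ 2 ≤ γ₁ * ‖φ‖ ^ 2

namespace Preconditioner

variable (P : Preconditioner)

/-- The space `𝒲₀ = {φ ∈ L²(Ω) : ℛφ ∈ H¹₀(Ω)}`. -/
def W0 : Submodule ℝ L2 := H10.comap P.R.toLinearMap

/-- The bounded operator `φ ↦ (ℛφ)'` on `L²(Ω)`. -/
def DR : L2 →L[ℝ] L2 :=
  LinearMap.mkContinuousOfExistsBound
    { toFun := fun φ => weakDeriv (P.R φ)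
      map_add' := fun φ ψ => by
        rw [map_add]
        exact ((isWeakDeriv_weakDeriv (P.map_L2 φ)).add
          (isWeakDeriv_weakDeriv (P.map_L2 ψ))).weakDeriv_eq
      map_smul' := fun t φ => by
        rw [map_smul]
        exact ((isWeakDeriv_weakDeriv (P.map_L2 φ)).smul t).weakDeriv_eq } (by
    obtain ⟨γ₀, γ₁, h0, h01, h⟩ := P.laplacian
    refine ⟨√γ₁, fun φ => ?_⟩
    have hγ : 0 ≤ γ₁ := h0.le.trans h01
    refine abs_le_of_sq_le_sq' ?_ (by positivity) |>.2
    rw [mul_pow, Real.sq_sqrt hγ]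
    exact (h φ).2)

theorem DR_apply (φ : L2) : P.DR φ = weakDeriv (P.R φ) := rfl

theorem isClosed_W0 : IsClosed (P.W0 : Set L2) := by
  have e : (P.W0 : Set L2) =
      (fun φ => (P.R φ, P.DR φ)) ⁻¹' (testGraph.topologicalClosure : Set (L2 × L2)) := by
    ext φ
    exact ⟨fun h => h.2, fun h => ⟨P.map_L2 φ, h⟩⟩
  rw [e]
  exact testGraph.isClosed_topologicalClosure.preimage (by fun_prop)

instance : CompleteSpace P.W0 := P.isClosed_W0.completeSpace_coe

/-- The orthogonal projection `Π` of `L²(Ω)` onto `𝒲₀`. -/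
def proj : L2 →L[ℝ] L2 := P.W0.starProjection

theorem proj_mem (φ : L2) : P.proj φ ∈ P.W0 := P.W0.starProjection_apply_mem φ

/-- The operator `𝒯 = Π* ℛ* ℒ ℛ Π`, with `ℒ` applied in the weak sense: as
`ℒu = -(a u')' + c u`, the operator `ℛ* ℒ ℛ` is `(dℛ)* a (dℛ) + ℛ* c ℛ`, where `dℛ φ = (ℛφ)'`.
See `inner_T` and `T_eq`. -/
def T (a c : Linf) : L2 →L[ℝ] L2 :=
  ContinuousLinearMap.adjoint P.proj ∘L
    (ContinuousLinearMap.adjoint P.DR ∘L mulOp a ∘L P.DR +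
      ContinuousLinearMap.adjoint P.R ∘L mulOp c ∘L P.R) ∘L P.proj

/-- The weak form of `𝒯`: it is the operator with `⟨𝒯φ, ψ⟩ = ℬ[ℛΠφ, ℛΠψ]`. -/
theorem inner_T (a c : Linf) (φ ψ : L2) :
    ⟪P.T a c φ, ψ⟫_ℝ = bform a c (P.R (P.proj φ)) (P.R (P.proj ψ)) := by
  simp only [T, ContinuousLinearMap.comp_apply, add_apply,
    ContinuousLinearMap.adjoint_inner_left, inner_add_left, bform_eq, DR_apply]

/-- If `u = ℛΠφ` can be inserted into `ℒ` in the strong sense, that is, if `a u'` has a weak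
derivative `h` in `L²(Ω)`, so that `ℒu = -h + c u`, then `𝒯φ` is literally `Π* ℛ* (ℒ u)`. -/
theorem T_eq (a c : Linf) (φ h : L2) (hh : IsWeakDeriv (mulOp a (weakDeriv (P.R (P.proj φ)))) h) :
    P.T a c φ = ContinuousLinearMap.adjoint P.proj
      (ContinuousLinearMap.adjoint P.R (-h + mulOp c (P.R (P.proj φ)))) := by
  refine ext_inner_right ℝ fun ψ => ?_
  rw [inner_T, ContinuousLinearMap.adjoint_inner_left, ContinuousLinearMap.adjoint_inner_left,
    bform_eq, inner_add_left]
  congr 1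
  set q := mulOp a (weakDeriv (P.R (P.proj φ)))
  set w := P.R (P.proj ψ)
  have hw : (w, weakDeriv w) ∈ testGraph.topologicalClosure := (P.proj_mem ψ).2
  have hS : IsClosed {X : L2 × L2 | ⟪q, X.2⟫_ℝ = ⟪-h, X.1⟫_ℝ} :=
    isClosed_eq (by fun_prop) (by fun_prop)
  refine closure_minimal ?_ hS hw
  rintro X ⟨η, hη, h1, h2⟩
  have k1 : ⟪h, X.1⟫_ℝ = ∫ x in Ω, h x * η x := by
    rw [L2.inner_def]
    refine integral_congr_ae ?_
    filter_upwards [h1] with x hx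
    simp [hx, mul_comm]
  have k2 : ⟪q, X.2⟫_ℝ = ∫ x in Ω, q x * deriv η x := by
    rw [L2.inner_def]
    refine integral_congr_ae ?_
    filter_upwards [h2] with x hx
    simp [hx, mul_comm]
  change ⟪q, X.2⟫_ℝ = ⟪-h, X.1⟫_ℝ
  rw [inner_neg_left, k1, k2, hh η hη]

/-- The restricted condition number
`κ_{𝒲₀}(𝒯) = (sup ⟨𝒯φ, φ⟩) / (inf ⟨𝒯φ, φ⟩)` over `φ ∈ 𝒲₀` with `‖φ‖ = 1`, as a value in `[0, ∞]`;
here `⟨𝒯φ, φ⟩ = ℬ[ℛφ, ℛφ]`, see `inner_T_self`. -/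
def condNumber (a c : Linf) : ℝ≥0∞ :=
  (⨆ φ ∈ {φ : L2 | φ ∈ P.W0 ∧ ‖φ‖ = 1}, ENNReal.ofReal ⟪P.T a c φ, φ⟫_ℝ) /
    (⨅ φ ∈ {φ : L2 | φ ∈ P.W0 ∧ ‖φ‖ = 1}, ENNReal.ofReal ⟪P.T a c φ, φ⟫_ℝ)

theorem inner_T_self (a c : Linf) {φ : L2} (hφ : φ ∈ P.W0) :
    ⟪P.T a c φ, φ⟫_ℝ = bform a c (P.R φ) (P.R φ) := by
  have : P.proj φ = φ := Submodule.starProjection_eq_self_iff.2 hφ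
  rw [inner_T, this]

end Preconditioner

/-- The factor `(√κ - 1) / (√κ + 1)`, with its limiting value `1` at `κ = ∞`. -/
def cgFactor (κ : ℝ≥0∞) : ℝ :=
  if κ = ⊤ then 1 else (√κ.toReal - 1) / (√κ.toReal + 1)

/-! ### The preconditioned CG method -/

/-- The data `(v_k, r_k, p_k)` held by the method after `k` steps. -/
structure CGState where
  /-- the iterate `v_k` -/
  v : L2
  /-- the residual `r_k` -/
  r : L2
  /-- the search direction `p_k` -/
  p : L2

/-- One pass through the loop. Once `r_k = 0` the divisions are by `0` with value `0`, so that a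
converged state no longer changes. -/
def cgStep (P : Preconditioner) (a c : Linf) (s : CGState) : CGState :=
  let α := ⟪s.r, s.r⟫_ℝ / bform a c (P.R s.p) (P.R s.p)
  let r' := s.r - α • P.T a c s.p
  let β := ⟪r', r'⟫_ℝ / ⟪s.r, s.r⟫_ℝ
  { v := s.v + α • s.p
    r := r'
    p := r' + β • s.p }

/-- The states of the preconditioned CG method for the right-hand side `f`. -/
def cgState (P : Preconditioner) (a c : Linf) (f : L2) : ℕ → CGState
  | 0 => { v := 0, r := ContinuousLinearMap.adjoint P.R f, p := ContinuousLinearMap.adjoint P.R f }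
  | k + 1 => cgStep P a c (cgState P a c f k)

/-- The iterates `u_k = ℛ v_k`. -/
def cgIterate (P : Preconditioner) (a c : Linf) (f : L2) (k : ℕ) : L2 :=
  P.R (cgState P a c f k).v

end OperatorCG

end

/-!
The error estimate is the classical one for the conjugate gradient method, applied to `𝒯` on the
invariant subspace `𝒲₀`. The equation `ℒu = f` with `u = ℛv` says `𝒯v = ℛ*f`
(`T_apply_of_isSolution`), the energy norm of `ℛφ` is `⟪𝒯φ, φ⟫^{1/2}`, and the preconditioned method
is the conjugate gradient method for this equation (`isCG_cgState`).

For a positive symmetric operator `A`, the residual of the `k`-th iterate is orthogonal to the `k`-th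
Krylov space (`IsCG.orthogonality`), so that the error has at most the energy of `q(A) x` for every
polynomial `q` of degree at most `k` with `q(0) = 1` (`IsCG.inner_error_le`). The choice of `q` is the
Chebyshev polynomial of the interval `[m, M]`. Its size at `A` is bounded without spectral calculus:
Pell's identity `T_k² + (1 - y²) U_(k-1)² = 1` (`chebPair_pell`) turns the bound into the positivity
of `A (A - m) (M - A)` (`inner_chebyshev_weight_nonneg`), which follows from `m ≤ A ≤ M`. The
recursion at `0` has the eigenvalues `(√M ± √m)²`, which produces the convergence factor
(`IsCG.sqrt_inner_error_le`).

The restricted condition number is `M / m` for the optimal bounds `m ≤ 𝒯 ≤ M` on `𝒲₀`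
(`Preconditioner.exists_condNumber_eq`). This needs `𝒲₀ ≠ 0`, since otherwise the supremum would
be taken over the empty set. On the interval, `H¹₀` is cut out of `H¹` by two linear conditions
(`mem_H10_of_inner_eq_zero`), so `𝒲₀` has codimension at most two in `L²(Ω)`. If `a` is bounded
below, then `𝒯` is coercive on `𝒲₀`, by the lower Laplacian bound of the preconditioner.
-/

noncomputable section

namespace OperatorCG

section PositiveOperator

open Polynomial

variable {E : Type*} [NormedAddCommGroup E] [InnerProductSpace ℝ E]

/-! ### Polynomials in a symmetric operator -/

theorem isSymmetric_aeval {A : E →ₗ[ℝ] E} (hA : A.IsSymmetric) (q : ℝ[X]) :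
    (aeval A q).IsSymmetric := by
  induction q using Polynomial.induction_on' with
  | add p q hp hq => rw [map_add]; exact hp.add hq
  | monomial n t =>
    intro x y
    have h := hA.pow n x y
    simp only [aeval_monomial, Algebra.algebraMap_eq_smul_one, smul_mul_assoc, one_mul,
      LinearMap.smul_apply, real_inner_smul_left, real_inner_smul_right, h]

theorem aeval_mem {A : E →ₗ[ℝ] E} {W : Submodule ℝ E} (hW : ∀ z ∈ W, A z ∈ W) (q : ℝ[X])
    {x : E} (hx : x ∈ W) : aeval A q x ∈ W := by
  induction q using Polynomial.induction_on' with
  | add p q hp hq => rw [map_add]; exact W.add_mem hp hq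
  | monomial n t =>
    have h : ∀ n : ℕ, (A ^ n) x ∈ W := by
      intro n
      induction n with
      | zero => simpa using hx
      | succ n ih => rw [pow_succ']; exact hW _ ih
    simp only [aeval_monomial, Algebra.algebraMap_eq_smul_one, smul_mul_assoc, one_mul,
      LinearMap.smul_apply]
    exact W.smul_mem _ (h n)

/-- If `m ≤ A ≤ M` on an invariant subspace, with `0 ≤ m`, then `A (A - m) (M - A) ≥ 0` there.
This is the only consequence of the spectral bounds that the Chebyshev estimate needs, and it
follows without a functional calculus: `A (A - m) (M - A) = (A - m)² (M - A) + m (A - m) (M - A)`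
and `(M - m) (A - m) (M - A) = (A - m)² (M - A) + (M - A)² (A - m)`. -/
theorem inner_chebyshev_weight_nonneg {A : E →ₗ[ℝ] E} (hA : A.IsSymmetric) {W : Submodule ℝ E}
    (hW : ∀ z ∈ W, A z ∈ W) {m M : ℝ} (hm : 0 ≤ m)
    (hlow : ∀ z ∈ W, m * ‖z‖ ^ 2 ≤ ⟪A z, z⟫_ℝ) (hup : ∀ z ∈ W, ⟪A z, z⟫_ℝ ≤ M * ‖z‖ ^ 2)
    {z : E} (hz : z ∈ W) :
    0 ≤ ⟪aeval A (X * ((X - C m) * (C M - X))) z, z⟫_ℝ := by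
  obtain ⟨y, hy⟩ : ∃ y, y = A z - m • z := ⟨_, rfl⟩
  obtain ⟨w, hw⟩ : ∃ w, w = M • z - A z := ⟨_, rfl⟩
  have hyW : y ∈ W := hy ▸ W.sub_mem (hW z hz) (W.smul_mem _ hz)
  have hwW : w ∈ W := hw ▸ W.sub_mem (W.smul_mem _ hz) (hW z hz)
  have s1 : ⟪A (A z), z⟫_ℝ = ⟪A z, A z⟫_ℝ := hA _ _
  have s2 : ⟪A (A (A z)), z⟫_ℝ = ⟪A (A z), A z⟫_ℝ := hA _ _
  have s3 : ⟪z, A z⟫_ℝ = ⟪A z, z⟫_ℝ := real_inner_comm _ _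
  have e0 : ⟪aeval A (X * ((X - C m) * (C M - X))) z, z⟫_ℝ
      = (M * ‖y‖ ^ 2 - ⟪A y, y⟫_ℝ) + m * ⟪w, y⟫_ℝ := by
    rw [← real_inner_self_eq_norm_sq y, hy, hw]
    simp only [map_mul, map_sub, aeval_X, aeval_C, Module.End.mul_apply, LinearMap.sub_apply,
      Module.algebraMap_end_apply, map_smul, inner_sub_left, inner_sub_right,
      real_inner_smul_left, real_inner_smul_right, s1, s2, s3]
    ring
  have e1 : (M - m) * ⟪w, y⟫_ℝ
      = (M * ‖y‖ ^ 2 - ⟪A y, y⟫_ℝ) + (⟪A w, w⟫_ℝ - m * ‖w‖ ^ 2) := by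
    rw [← real_inner_self_eq_norm_sq y, ← real_inner_self_eq_norm_sq w, hy, hw]
    simp only [map_sub, map_smul, inner_sub_left, inner_sub_right,
      real_inner_smul_left, real_inner_smul_right, s1, s3]
    ring
  have h1 := hup y hyW
  have h2 := hlow w hwW
  have h3 : 0 ≤ ⟪w, y⟫_ℝ := by
    rcases lt_trichotomy m M with h | h | h
    · exact nonneg_of_mul_nonneg_right (by rw [e1]; linarith) (sub_pos.2 h)
    · -- here `⟪A ·, ·⟫ = m ‖·‖²` on `W`, and polarization gives `y = 0`
      have k (q : E) (hq : q ∈ W) : ⟪A q, q⟫_ℝ = m * ⟪q, q⟫_ℝ := by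
        rw [real_inner_self_eq_norm_sq]
        exact le_antisymm (h ▸ hup q hq) (hlow q hq)
      have k1 := k (z + y) (W.add_mem hz hyW)
      have k2 : ⟪A y, z⟫_ℝ = ⟪A z, y⟫_ℝ := by rw [hA, real_inner_comm]
      simp only [map_add, inner_add_left, inner_add_right, k z hz, k y hyW, k2,
        real_inner_comm z y] at k1
      have k3 : ⟪y, y⟫_ℝ = 0 := by
        nth_rewrite 1 [hy]
        rw [inner_sub_left, real_inner_smul_left]
        linarith
      simp [inner_self_eq_zero.1 k3]
    · -- the bounds are compatible with `M < m` only if `z = 0`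
      have k : ‖z‖ ^ 2 = 0 := by nlinarith [hlow z hz, hup z hz, sq_nonneg ‖z‖]
      have : z = 0 := by simpa using k
      simp [hw, this]
  rw [e0]
  nlinarith [mul_nonneg hm h3]

/-! ### Chebyshev polynomials on `[m, M]` -/

/-- The pair `(δ^k T_k(y/δ), δ^(k-1) U_(k-1)(y/δ))` of rescaled Chebyshev polynomials of the first
and second kind, where `δ = M - m` and `y = M + m - 2X` maps `[m, M]` onto `[-δ, δ]`. The powers of
`δ` make the case `m = M` harmless. The weight `δ² - y²` equals `4 (X - m) (M - X)`. -/
def chebPair (m M : ℝ) : ℕ → ℝ[X] × ℝ[X]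
  | 0 => (1, 0)
  | k + 1 =>
    ((C (M + m) - C 2 * X) * (chebPair m M k).1
        - C 4 * ((X - C m) * (C M - X)) * (chebPair m M k).2,
      (C (M + m) - C 2 * X) * (chebPair m M k).2 + (chebPair m M k).1)

/-- The Pell identity `T_k² + (1 - y²) U_(k-1)² = 1`, rescaled. -/
theorem chebPair_pell (m M : ℝ) (k : ℕ) :
    (chebPair m M k).1 ^ 2 + C 4 * ((X - C m) * (C M - X)) * (chebPair m M k).2 ^ 2
      = C (((M - m) ^ 2) ^ k) := by
  induction k with
  | zero => simp [chebPair]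
  | succ k ih =>
    rw [pow_succ ((M - m) ^ 2), C_mul, ← ih]
    simp only [chebPair, C_add, C_sub, C_pow]
    have h2 : (C 2 : ℝ[X]) = 2 := map_ofNat C 2
    have h4 : (C 4 : ℝ[X]) = 4 := map_ofNat C 4
    rw [h2, h4]
    ring

theorem chebPair_natDegree (m M : ℝ) (k : ℕ) :
    (chebPair m M k).1.natDegree ≤ k ∧ (chebPair m M k).2.natDegree ≤ k - 1 ∧
      (k = 0 → (chebPair m M k).2 = 0) := by
  induction k with
  | zero => simp [chebPair]
  | succ k ih =>
    obtain ⟨h1, h2, h3⟩ := ih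
    have hB : (C (M + m) - C 2 * X : ℝ[X]).natDegree ≤ 1 := by compute_degree
    have hD : (C 4 * ((X - C m) * (C M - X)) : ℝ[X]).natDegree ≤ 2 := by compute_degree
    refine ⟨?_, ?_, by simp⟩
    · refine (natDegree_sub_le _ _).trans
        (max_le ((natDegree_mul_le_of_le hB h1).trans (by omega)) ?_)
      rcases Nat.eq_zero_or_pos k with rfl | hk
      · simp [h3 rfl]
      · exact (natDegree_mul_le_of_le hD h2).trans (by omega)
    · refine (natDegree_add_le _ _).trans (max_le ?_ (by simpa using h1))
      rcases Nat.eq_zero_or_pos k with rfl | hk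
      · simp [h3 rfl]
      · exact (natDegree_mul_le_of_le hB h2).trans (by omega)

theorem chebPair_eval_zero {m M : ℝ} (hm : 0 ≤ m) (hM : 0 ≤ M) (k : ℕ) :
    (√M + √m) ^ k * (√M + √m) ^ k ≤ 2 * (chebPair m M k).1.eval 0 := by
  -- `M + m ± 2√M√m = (√M ± √m)²` are the eigenvalues of the recursion at `X = 0`
  have key : ∀ t : ℝ, t ^ 2 = m → (chebPair m M k).1.eval 0
      + 2 * (√M * t) * (chebPair m M k).2.eval 0 = (√M + t) ^ k * (√M + t) ^ k := by
    intro t ht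
    have hs : √M ^ 2 = M := Real.sq_sqrt hM
    induction k with
    | zero => simp [chebPair]
    | succ k ih =>
      rw [pow_succ, mul_mul_mul_comm, ← ih]
      simp only [chebPair, eval_sub, eval_mul, eval_add, eval_C, eval_X]
      rw [← ht, ← hs, Real.sqrt_sq (Real.sqrt_nonneg M)]
      ring
  have h1 := key (√m) (Real.sq_sqrt hm)
  have h2 := key (-√m) (by rw [neg_sq, Real.sq_sqrt hm])
  nlinarith [mul_self_nonneg ((√M + -√m) ^ k)]

/-- `δ^k T_k(y/δ)` evaluated at `A` has norm at most `δ^k` in the energy norm of `A`. -/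
theorem inner_chebPair_le {A : E →ₗ[ℝ] E} (hA : A.IsSymmetric) {W : Submodule ℝ E}
    (hW : ∀ z ∈ W, A z ∈ W) {m M : ℝ} (hm : 0 ≤ m)
    (hlow : ∀ z ∈ W, m * ‖z‖ ^ 2 ≤ ⟪A z, z⟫_ℝ) (hup : ∀ z ∈ W, ⟪A z, z⟫_ℝ ≤ M * ‖z‖ ^ 2)
    {x : E} (hx : x ∈ W) (k : ℕ) :
    ⟪A (aeval A (chebPair m M k).1 x), aeval A (chebPair m M k).1 x⟫_ℝ
      ≤ ((M - m) ^ 2) ^ k * ⟪A x, x⟫_ℝ := by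
  set p := (chebPair m M k).1
  set q := (chebPair m M k).2
  have h := inner_chebyshev_weight_nonneg hA hW hm hlow hup (aeval_mem hW q hx)
  rw [← isSymmetric_aeval hA q] at h
  have h' : ((M - m) ^ 2) ^ k * ⟪A x, x⟫_ℝ - ⟪A (aeval A p x), aeval A p x⟫_ℝ
      = ⟪aeval A (((M - m) ^ 2) ^ k • (X : ℝ[X]) - p * (X * p)) x, x⟫_ℝ := by
    rw [← isSymmetric_aeval hA p]
    simp only [map_sub, map_smul, map_mul, aeval_X, Module.End.mul_apply, LinearMap.sub_apply,
      LinearMap.smul_apply, inner_sub_left, real_inner_smul_left]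
  rw [← sub_nonneg, h']
  have e : ((M - m) ^ 2) ^ k • (X : ℝ[X]) - p * (X * p)
      = (4 : ℝ) • (q * (X * ((X - C m) * (C M - X))) * q) := by
    rw [smul_eq_C_mul, smul_eq_C_mul, ← chebPair_pell m M k]
    ring
  rw [e, map_smul, LinearMap.smul_apply, real_inner_smul_left, map_mul, map_mul,
    Module.End.mul_apply, Module.End.mul_apply]
  exact mul_nonneg (by norm_num) h

/-! ### The conjugate gradient method for a positive symmetric operator -/

/-- The recurrences of the conjugate gradient method for `A x = b`, with divisions by zero read as
zero. -/
structure IsCG (A : E →ₗ[ℝ] E) (b : E) (v r p : ℕ → E) : Prop where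
  v_zero : v 0 = 0
  r_zero : r 0 = b
  p_zero : p 0 = b
  v_succ : ∀ k, v (k + 1) = v k + (⟪r k, r k⟫_ℝ / ⟪A (p k), p k⟫_ℝ) • p k
  r_succ : ∀ k, r (k + 1) = r k - (⟪r k, r k⟫_ℝ / ⟪A (p k), p k⟫_ℝ) • A (p k)
  p_succ : ∀ k, p (k + 1) = r (k + 1) + (⟪r (k + 1), r (k + 1)⟫_ℝ / ⟪r k, r k⟫_ℝ) • p k

/-- A positive symmetric operator annihilates the vectors of zero energy. -/
theorem apply_eq_zero_of_inner_eq_zero {A : E →ₗ[ℝ] E} (hA : A.IsSymmetric)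
    (hpos : ∀ z, 0 ≤ ⟪A z, z⟫_ℝ) {z : E} (hz : ⟪A z, z⟫_ℝ = 0) : A z = 0 := by
  have h (t : ℝ) : 0 ≤ (⟪A (A z), A z⟫_ℝ) * (t * t) + (2 * ⟪A z, A z⟫_ℝ) * t + 0 := by
    have := hpos (z + t • A z)
    have e : ⟪A (A z), z⟫_ℝ = ⟪A z, A z⟫_ℝ := hA _ _
    simp only [map_add, map_smul, inner_add_left, inner_add_right, real_inner_smul_left,
      real_inner_smul_right, hz, e] at this
    linarith
  have hd := discrim_le_zero h
  rw [discrim] at hd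
  have : ⟪A z, A z⟫_ℝ ^ 2 ≤ 0 := by linarith
  exact inner_self_eq_zero.1 (pow_eq_zero_iff (two_ne_zero) |>.1 (le_antisymm this (sq_nonneg _)))

namespace IsCG

variable {A : E →ₗ[ℝ] E} {b x : E} {v r p : ℕ → E}

theorem r_eq (h : IsCG A b v r p) (hx : A x = b) (k : ℕ) : r k = A (x - v k) := by
  induction k with
  | zero => simp [h.r_zero, h.v_zero, hx]
  | succ k ih =>
    rw [h.r_succ, h.v_succ, ih]
    simp only [map_sub, map_add, map_smul]
    abel

theorem mem (h : IsCG A b v r p) {W : Submodule ℝ E} (hW : ∀ z ∈ W, A z ∈ W) (hb : b ∈ W)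
    (k : ℕ) : v k ∈ W ∧ r k ∈ W ∧ p k ∈ W := by
  induction k with
  | zero => rw [h.v_zero, h.r_zero, h.p_zero]; exact ⟨W.zero_mem, hb, hb⟩
  | succ k ih =>
    obtain ⟨h1, h2, h3⟩ := ih
    have h4 : r (k + 1) ∈ W := by
      rw [h.r_succ]; exact W.sub_mem h2 (W.smul_mem _ (hW _ h3))
    refine ⟨?_, h4, ?_⟩
    · rw [h.v_succ]; exact W.add_mem h1 (W.smul_mem _ h3)
    · rw [h.p_succ]; exact W.add_mem h4 (W.smul_mem _ h3)

theorem r_eq_zero_of_le (h : IsCG A b v r p) {j k : ℕ} (hjk : j ≤ k) (hj : r j = 0) :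
    r k = 0 := by
  induction k, hjk using Nat.le_induction with
  | base => exact hj
  | succ k _ ih => rw [h.r_succ, ih]; simp

/-- The span of the first `k` search directions. -/
def searchSpace (p : ℕ → E) (k : ℕ) : Submodule ℝ E := Submodule.span ℝ (p '' Set.Iio k)

theorem p_mem_searchSpace (p : ℕ → E) {j k : ℕ} (hjk : j < k) : p j ∈ searchSpace p k :=
  Submodule.subset_span ⟨j, hjk, rfl⟩

theorem searchSpace_mono (p : ℕ → E) {j k : ℕ} (hjk : j ≤ k) :
    searchSpace p j ≤ searchSpace p k :=
  Submodule.span_mono (Set.image_mono (Set.Iio_subset_Iio hjk))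

theorem inner_eq_zero_of_mem_searchSpace {y z : E} {k : ℕ} (hy : ∀ j < k, ⟪y, p j⟫_ℝ = 0)
    (hz : z ∈ searchSpace p k) : ⟪y, z⟫_ℝ = 0 := by
  have : searchSpace p k ≤ LinearMap.ker (innerₛₗ ℝ y) := by
    rw [searchSpace, Submodule.span_le]
    rintro _ ⟨j, hj, rfl⟩
    exact hy j hj
  exact this hz

theorem r_mem_searchSpace (h : IsCG A b v r p) (k : ℕ) : r k ∈ searchSpace p (k + 1) := by
  cases k with
  | zero => rw [h.r_zero, ← h.p_zero]; exact p_mem_searchSpace p (by omega)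
  | succ k =>
    rw [eq_sub_of_add_eq (h.p_succ k).symm]
    exact Submodule.sub_mem _ (p_mem_searchSpace p (by omega))
      (Submodule.smul_mem _ _ (p_mem_searchSpace p (by omega)))

theorem v_mem_searchSpace (h : IsCG A b v r p) (k : ℕ) : v k ∈ searchSpace p k := by
  induction k with
  | zero => rw [h.v_zero]; exact Submodule.zero_mem _
  | succ k ih =>
    rw [h.v_succ]
    exact Submodule.add_mem _ (searchSpace_mono p (by omega) ih)
      (Submodule.smul_mem _ _ (p_mem_searchSpace p (by omega)))

/-- The residuals are orthogonal to the previous search directions, and the search directions are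
`A`-conjugate. By the first conjunct, the denominator of the step length vanishes only if the
residual does. -/
theorem orthogonality (h : IsCG A b v r p) (hA : A.IsSymmetric) (hpos : ∀ z, 0 ≤ ⟪A z, z⟫_ℝ)
    (hx : A x = b) (k : ℕ) (hr : ∀ j < k, r j ≠ 0) :
    ⟪r k, p k⟫_ℝ = ⟪r k, r k⟫_ℝ ∧ (∀ j < k, ⟪r k, p j⟫_ℝ = 0) ∧
      (∀ j < k, ⟪A (p k), p j⟫_ℝ = 0) ∧ ∀ j < k, ⟪A (p j), p j⟫_ℝ ≠ 0 := by
  induction k with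
  | zero => simp [h.r_zero, h.p_zero]
  | succ k ih =>
    obtain ⟨i1, i2, i3, i4⟩ := ih fun j hj => hr j (by omega)
    have hrk : ⟪r k, r k⟫_ℝ ≠ 0 := inner_self_ne_zero.2 (hr k (by omega))
    have hpk : ⟪A (p k), p k⟫_ℝ ≠ 0 := by
      intro h0
      apply hrk
      rw [← i1, h.r_eq hx k, hA, apply_eq_zero_of_inner_eq_zero hA hpos h0, inner_zero_right]
    have j4 : ∀ j < k + 1, ⟪A (p j), p j⟫_ℝ ≠ 0 := by
      intro j hj
      rcases Nat.lt_succ_iff_lt_or_eq.1 hj with hj | rfl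
      exacts [i4 j hj, hpk]
    have j2 : ∀ j < k + 1, ⟪r (k + 1), p j⟫_ℝ = 0 := by
      intro j hj
      rw [h.r_succ, inner_sub_left, real_inner_smul_left]
      rcases Nat.lt_succ_iff_lt_or_eq.1 hj with hj | rfl
      · rw [i2 j hj, i3 j hj]; ring
      · rw [i1]; field_simp; ring
    have hrr : ∀ j < k + 1, ⟪r (k + 1), r j⟫_ℝ = 0 := fun j hj =>
      inner_eq_zero_of_mem_searchSpace j2
        (searchSpace_mono p (by omega : j + 1 ≤ k + 1) (h.r_mem_searchSpace j))
    refine ⟨?_, j2, ?_, j4⟩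
    · rw [h.p_succ, inner_add_right, real_inner_smul_right, j2 k (by omega)]; ring
    · intro j hj
      have hrj : ⟪r j, r j⟫_ℝ ≠ 0 := inner_self_ne_zero.2 (hr j hj)
      have hpj := j4 j hj
      have e : ⟪r (k + 1), A (p j)⟫_ℝ
          = (⟪A (p j), p j⟫_ℝ / ⟪r j, r j⟫_ℝ) * (0 - ⟪r (k + 1), r (j + 1)⟫_ℝ) := by
        rw [h.r_succ j, inner_sub_right, real_inner_smul_right, hrr j hj]
        field_simp
        ring
      nth_rewrite 1 [h.p_succ]
      rw [hA, inner_add_left, real_inner_smul_left, e, ← hA (p k)]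
      rcases Nat.lt_succ_iff_lt_or_eq.1 hj with hj | rfl
      · rw [i3 j hj, hrr (j + 1) (by omega)]; ring
      · field_simp; ring

theorem aeval_mem_searchSpace (h : IsCG A b v r p) {k : ℕ} (hr : ∀ j < k, r j ≠ 0)
    (hp : ∀ j < k, ⟪A (p j), p j⟫_ℝ ≠ 0) (q : ℝ[X]) (hq : ∀ n, k ≤ n → q.coeff n = 0) :
    aeval A q b ∈ searchSpace p k := by
  have step (j : ℕ) (hj : j < k) (z : E) (hz : z ∈ searchSpace p j) :
      A z ∈ searchSpace p (j + 1) := by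
    have : searchSpace p j ≤ (searchSpace p (j + 1)).comap A := by
      rw [searchSpace, Submodule.span_le]
      rintro _ ⟨i, hi : i < j, rfl⟩
      have hri : ⟪r i, r i⟫_ℝ ≠ 0 := inner_self_ne_zero.2 (hr i (by omega))
      have hpi := hp i (by omega)
      have e : A (p i) = (⟪A (p i), p i⟫_ℝ / ⟪r i, r i⟫_ℝ) • (r i - r (i + 1)) := by
        rw [h.r_succ, sub_sub_cancel, smul_smul, div_mul_div_comm, mul_comm, div_self
          (mul_ne_zero hri hpi), one_smul]
      change A (p i) ∈ searchSpace p (j + 1)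
      rw [e]
      exact Submodule.smul_mem _ _ (Submodule.sub_mem _
        (searchSpace_mono p (by omega) (h.r_mem_searchSpace i))
        (searchSpace_mono p (by omega) (h.r_mem_searchSpace (i + 1))))
    exact this hz
  have hpow : ∀ n < k, (A ^ n) b ∈ searchSpace p (n + 1) := by
    intro n
    induction n with
    | zero => intro _; rw [← h.p_zero]; exact p_mem_searchSpace p (by omega)
    | succ n ih =>
      intro hn
      rw [pow_succ']
      exact step (n + 1) (by omega) _ (ih (by omega))
  rw [aeval_eq_sum_range, LinearMap.sum_apply]
  refine Submodule.sum_mem _ fun n _ => ?_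
  rw [LinearMap.smul_apply]
  by_cases hn : n < k
  · exact Submodule.smul_mem _ _ (searchSpace_mono p (by omega) (hpow n hn))
  · rw [hq n (by omega), zero_smul]; exact Submodule.zero_mem _

/-- The iterate `v k` minimizes the energy of the error among all `q(A) b` with `deg q < k`; the
errors of these are the `q(A) x` with `deg q ≤ k` and `q(0) = 1`. -/
theorem inner_error_le (h : IsCG A b v r p) (hA : A.IsSymmetric) (hpos : ∀ z, 0 ≤ ⟪A z, z⟫_ℝ)
    (hx : A x = b) (k : ℕ) (q : ℝ[X]) (hq : q.natDegree ≤ k) (hq0 : q.eval 0 = 1) :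
    ⟪A (x - v k), x - v k⟫_ℝ ≤ ⟪A (aeval A q x), aeval A q x⟫_ℝ := by
  by_cases hr : ∃ j < k, r j = 0
  · obtain ⟨j, hj, hrj⟩ := hr
    rw [← h.r_eq hx, h.r_eq_zero_of_le hj.le hrj, inner_zero_left]
    exact hpos _
  · push Not at hr
    obtain ⟨-, h2, -, h4⟩ := h.orthogonality hA hpos hx k hr
    -- `q = 1 + q.divX * X`, so that `q(A) x = x + q.divX(A) b`
    have e : aeval A q x = x + aeval A q.divX b := by
      nth_rewrite 1 [← q.divX_mul_X_add]
      rw [coeff_zero_eq_eval_zero, hq0]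
      simp [hx, add_comm]
    have hmem : aeval A q.divX b + v k ∈ searchSpace p k := by
      refine Submodule.add_mem _ (h.aeval_mem_searchSpace hr h4 _ fun n hn => ?_)
        (h.v_mem_searchSpace k)
      rw [coeff_divX]
      exact coeff_eq_zero_of_natDegree_lt (by omega)
    obtain ⟨d, hd⟩ : ∃ d, d = aeval A q.divX b + v k := ⟨_, rfl⟩
    have e' : aeval A q x = (x - v k) + d := by rw [e, hd]; abel
    have o : ⟪A (x - v k), d⟫_ℝ = 0 := by
      rw [← h.r_eq hx]
      exact inner_eq_zero_of_mem_searchSpace h2 (hd ▸ hmem)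
    have o' : ⟪A d, x - v k⟫_ℝ = 0 := by rw [hA, real_inner_comm, o]
    rw [e', map_add, inner_add_left, inner_add_right, inner_add_right, o, o']
    linarith [hpos d]

/-- The convergence estimate of the conjugate gradient method, for a positive symmetric operator
that lies between `m` and `M` on an invariant subspace containing the solution. -/
theorem sqrt_inner_error_le (h : IsCG A b v r p) (hA : A.IsSymmetric)
    (hpos : ∀ z, 0 ≤ ⟪A z, z⟫_ℝ) (hx : A x = b) {W : Submodule ℝ E} (hW : ∀ z ∈ W, A z ∈ W)
    (hxW : x ∈ W) {m M : ℝ} (hm : 0 ≤ m) (hM : 0 < M) (hmM : m ≤ M)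
    (hlow : ∀ z ∈ W, m * ‖z‖ ^ 2 ≤ ⟪A z, z⟫_ℝ) (hup : ∀ z ∈ W, ⟪A z, z⟫_ℝ ≤ M * ‖z‖ ^ 2)
    (k : ℕ) :
    √⟪A (x - v k), x - v k⟫_ℝ ≤ 2 * ((√M - √m) / (√M + √m)) ^ k * √⟪A x, x⟫_ℝ := by
  set T := (chebPair m M k).1 with hT
  have h0 := chebPair_eval_zero hm hM.le k
  rw [← hT] at h0
  have hsM : 0 < √M := Real.sqrt_pos.2 hM
  have hs : 0 < √M + √m := add_pos_of_pos_of_nonneg hsM (Real.sqrt_nonneg m)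
  have hd : 0 ≤ √M - √m := sub_nonneg.2 (Real.sqrt_le_sqrt hmM)
  have hsk : 0 < (√M + √m) ^ k := pow_pos hs k
  have hT0 : 0 < T.eval 0 := by
    have : 0 < (√M + √m) ^ k * (√M + √m) ^ k := mul_pos hsk hsk
    linarith
  have hopt := h.inner_error_le hA hpos hx k (C (T.eval 0)⁻¹ * T)
    ((natDegree_C_mul_le _ _).trans (chebPair_natDegree m M k).1)
    (by rw [eval_mul, eval_C, inv_mul_cancel₀ hT0.ne'])
  have hc := inner_chebPair_le hA hW hm hlow hup hxW k
  rw [← hT, ← pow_mul, mul_comm 2 k, pow_mul] at hc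
  have e : aeval A (C (T.eval 0)⁻¹ * T) x = (T.eval 0)⁻¹ • aeval A T x := by simp
  rw [e, map_smul, real_inner_smul_left, real_inner_smul_right] at hopt
  have hδ : (M - m) = (√M - √m) * (√M + √m) := by
    nlinarith [Real.sq_sqrt hm, Real.sq_sqrt hM.le]
  have hfac : (T.eval 0)⁻¹ * (M - m) ^ k ≤ 2 * ((√M - √m) / (√M + √m)) ^ k := by
    rw [hδ, mul_pow, div_pow, inv_mul_le_iff₀ hT0]
    have hdk : 0 ≤ (√M - √m) ^ k := pow_nonneg hd k
    rw [← mul_div_assoc, ← mul_div_assoc, le_div_iff₀ hsk]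
    nlinarith [mul_le_mul_of_nonneg_left h0 hdk]
  have hδ0 : 0 ≤ (T.eval 0)⁻¹ * (M - m) ^ k :=
    mul_nonneg (inv_nonneg.2 hT0.le) (pow_nonneg (sub_nonneg.2 hmM) k)
  calc √⟪A (x - v k), x - v k⟫_ℝ
      ≤ √(((T.eval 0)⁻¹ * (M - m) ^ k) ^ 2 * ⟪A x, x⟫_ℝ) := by
        refine Real.sqrt_le_sqrt (hopt.trans ?_)
        have := mul_le_mul_of_nonneg_left hc (mul_self_nonneg (T.eval 0)⁻¹)
        calc _ = (T.eval 0)⁻¹ * (T.eval 0)⁻¹ * ⟪A (aeval A T x), aeval A T x⟫_ℝ := by ring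
          _ ≤ _ := this
          _ = _ := by ring
    _ = (T.eval 0)⁻¹ * (M - m) ^ k * √⟪A x, x⟫_ℝ := by
        rw [Real.sqrt_mul (sq_nonneg _), Real.sqrt_sq hδ0]
    _ ≤ _ := mul_le_mul_of_nonneg_right hfac (Real.sqrt_nonneg _)

end IsCG

end PositiveOperator

/-! ### Weak derivatives on the interval -/

theorem inner_toLp (g : L2) {η : ℝ → ℝ} (hη : MemLp η 2 μΩ) :
    ⟪g, hη.toLp η⟫_ℝ = ∫ x in Ω, g x * η x := by
  rw [L2.inner_def]
  refine integral_congr_ae ?_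
  filter_upwards [hη.coeFn_toLp] with x hx
  simp [hx, mul_comm]

theorem isWeakDeriv_iff_inner {u g : L2} : IsWeakDeriv u g ↔ ∀ (η : ℝ → ℝ) (h : IsTest η),
    ⟪u, h.deriv_memLp.toLp (deriv η)⟫_ℝ = - ⟪g, h.memLp.toLp η⟫_ℝ := by
  simp only [inner_toLp]
  rfl

theorem setIntegral_deriv_eq_zero {F F' : ℝ → ℝ} (hF : ∀ x, HasDerivAt F (F' x) x)
    (hc : Continuous F') (h1 : F (-1) = 0) (h2 : F 1 = 0) : ∫ x in Ω, F' x = 0 := by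
  rw [← integral_Ioc_eq_integral_Ioo, ← intervalIntegral.integral_of_le (by norm_num),
    intervalIntegral.integral_eq_sub_of_hasDerivAt (fun x _ => hF x) (hc.intervalIntegrable _ _),
    h1, h2, sub_zero]

theorem IsTest.eq_zero {η : ℝ → ℝ} (h : IsTest η) {x : ℝ} (hx : x ∉ Ω) : η x = 0 :=
  image_eq_zero_of_notMem_tsupport fun hx' => hx (h.2.2 hx')

theorem IsTest.hasDerivAt {η : ℝ → ℝ} (h : IsTest η) (x : ℝ) : HasDerivAt η (deriv η x) x :=
  (h.1.differentiable (by simp) x).hasDerivAt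

theorem IsTest.continuous_deriv {η : ℝ → ℝ} (h : IsTest η) : Continuous (deriv η) :=
  h.1.continuous_deriv (by simp)

theorem memLp_of_continuous {F : ℝ → ℝ} (hF : Continuous F) : MemLp F 2 μΩ := by
  obtain ⟨B, hB⟩ := (isCompact_Icc (a := (-1 : ℝ)) (b := 1)).exists_bound_of_continuousOn
    hF.continuousOn
  refine MemLp.of_bound hF.aestronglyMeasurable B ?_
  rw [ae_restrict_iff' measurableSet_Ioo]
  exact Eventually.of_forall fun x hx => hB x (Set.Ioo_subset_Icc_self hx)

theorem integrable_of_continuous {F : ℝ → ℝ} (hF : Continuous F) : Integrable F μΩ :=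
  (memLp_of_continuous hF).integrable (by norm_num)

/-- The constant function `1`, as an element of `L²(Ω)`. -/
def one : L2 := (memLp_of_continuous (continuous_const (y := (1 : ℝ)))).toLp fun _ => 1

/-- The function `x ↦ x`, as an element of `L²(Ω)`. -/
def coord : L2 := (memLp_of_continuous continuous_id).toLp id

theorem inner_one (g : L2) : ⟪g, one⟫_ℝ = ∫ x in Ω, g x := by
  rw [one, inner_toLp]; simp

theorem one_ne_zero : one ≠ 0 := by
  intro h
  have h1 : ⟪one, one⟫_ℝ = 2 := by
    rw [inner_one, one, integral_congr_ae (MemLp.coeFn_toLp _)]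
    simp [Measure.real]
    norm_num
  rw [h, inner_zero_left] at h1
  norm_num at h1

/-- A primitive of a test function of mean zero is a test function. -/
theorem IsTest.exists_primitive {η : ℝ → ℝ} (h : IsTest η) (h0 : ∫ x in Ω, η x = 0) :
    ∃ ζ, IsTest ζ ∧ deriv ζ = η := by
  have hc : Continuous η := h.1.continuous
  have hd : ∀ x, HasDerivAt (fun x => ∫ t in (-1)..x, η t) (η x) x := fun x =>
    hc.integral_hasStrictDerivAt (-1) x |>.hasDerivAt
  have hderiv : deriv (fun x => ∫ t in (-1)..x, η t) = η := funext fun x => (hd x).deriv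
  -- the support of `η` lies in a compact subinterval `[s, t]` of `Ω`
  obtain ⟨s, t, hs, ht, hst⟩ : ∃ s t : ℝ, -1 < s ∧ t < 1 ∧ tsupport η ⊆ Set.Icc s t := by
    rcases (tsupport η).eq_empty_or_nonempty with he | hne
    · exact ⟨0, 0, by norm_num, by norm_num, by simp [he]⟩
    · have hK : IsCompact (tsupport η) := h.2.1
      exact ⟨sInf (tsupport η), sSup (tsupport η), (h.2.2 (hK.sInf_mem hne)).1,
        (h.2.2 (hK.sSup_mem hne)).2, fun x hx => ⟨csInf_le hK.bddBelow hx, le_csSup hK.bddAbove hx⟩⟩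
  have hz : ∀ x, x ∉ Set.Icc s t → η x = 0 := fun x hx =>
    image_eq_zero_of_notMem_tsupport fun hx' => hx (hst hx')
  have h1 : ∫ x in (-1)..1, η x = 0 := by
    rw [intervalIntegral.integral_of_le (by norm_num), integral_Ioc_eq_integral_Ioo, h0]
  have hsupp : Function.support (fun x => ∫ t in (-1)..x, η t) ⊆ Set.Icc s t := by
    intro x hx
    by_contra hx'
    apply hx
    rcases not_and_or.1 hx' with hxs | hxt
    · refine intervalIntegral.integral_zero_ae (Eventually.of_forall fun y hy => hz y fun hy' => ?_)
      have := (Set.mem_uIoc.1 hy)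
      rcases this with this | this <;> linarith [hy'.1, this.2]
    · have : ∫ t in x..1, η t = 0 := by
        refine intervalIntegral.integral_zero_ae
          (Eventually.of_forall fun y hy => hz y fun hy' => ?_)
        have := (Set.mem_uIoc.1 hy)
        rcases this with this | this <;> linarith [hy'.2, this.1]
      have h2 := intervalIntegral.integral_add_adjacent_intervals (μ := volume)
        (hc.intervalIntegrable (-1) x) (hc.intervalIntegrable x 1)
      change ∫ t in (-1)..x, η t = 0
      linarith
  have htsupp : tsupport (fun x => ∫ t in (-1)..x, η t) ⊆ Set.Icc s t :=
    closure_minimal hsupp isClosed_Icc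
  refine ⟨_, ⟨contDiff_infty_iff_deriv.2 ⟨fun x => (hd x).differentiableAt, ?_⟩, ?_, ?_⟩, hderiv⟩
  · rw [hderiv]; exact h.1
  · exact HasCompactSupport.of_support_subset_isCompact isCompact_Icc hsupp
  · exact htsupp.trans (Set.Icc_subset_Ioo hs ht)

theorem exists_isTest_integral_eq_one : ∃ η, IsTest η ∧ ∫ x in Ω, η x = 1 := by
  let B : ContDiffBump (0 : ℝ) := ⟨1 / 4, 1 / 2, by norm_num, by norm_num⟩
  have hs : tsupport (B.normed volume) ⊆ Ω := by
    rw [B.tsupport_normed_eq]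
    intro x hx
    rw [Real.closedBall_eq_Icc] at hx
    have h1 : B.rOut = 1 / 2 := rfl
    rw [h1] at hx
    exact ⟨by linarith [hx.1], by linarith [hx.2]⟩
  refine ⟨B.normed volume, ⟨B.contDiff_normed, B.hasCompactSupport_normed, hs⟩, ?_⟩
  rw [setIntegral_eq_integral_of_forall_compl_eq_zero, B.integral_normed]
  exact fun x hx => image_eq_zero_of_notMem_tsupport fun hx' => hx (hs hx')

/-- A function with vanishing weak derivative is constant: it is orthogonal to all test functions
of mean zero, since these have test functions as primitives. -/
theorem IsWeakDeriv.exists_eq_smul_one {u : L2} (hu : IsWeakDeriv u 0) :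
    ∃ C : ℝ, u = C • one := by
  obtain ⟨η₀, h₀, hi⟩ := exists_isTest_integral_eq_one
  set C := ∫ x in Ω, u x * η₀ x with hC
  refine ⟨C, ?_⟩
  have hone : ∀ {η : ℝ → ℝ}, IsTest η → ∫ x in Ω, one x * η x = ∫ x in Ω, η x := fun _ => by
    refine integral_congr_ae ?_
    filter_upwards [MemLp.coeFn_toLp (memLp_of_continuous (continuous_const (y := (1 : ℝ))))]
      with x hx
    change (MemLp.toLp _ _ : L2) x * _ = _
    rw [hx, one_mul]
  -- a function orthogonal to all test functions is a weak derivative of `0`, hence vanishes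
  have key : IsWeakDeriv 0 (u - C • one) := by
    rw [isWeakDeriv_iff_inner]
    intro η hη
    rw [inner_zero_left, inner_sub_left, real_inner_smul_left, inner_toLp, inner_toLp, hone hη]
    set I := ∫ x in Ω, η x with hI
    have hθ : IsTest (η + (-I) • η₀) := by
      refine ⟨hη.1.add (h₀.1.const_smul (-I)), hη.2.1.add h₀.2.1.smul_left, ?_⟩
      exact (tsupport_add _ _).trans (Set.union_subset hη.2.2
        ((closure_mono (Function.support_const_smul_subset _ _)).trans h₀.2.2))
    obtain ⟨ζ, hζ, hζ'⟩ := hθ.exists_primitive (by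
      simp only [Pi.add_apply, Pi.smul_apply, smul_eq_mul]
      rw [integral_add (hη.memLp.integrable (by norm_num))
        ((h₀.memLp.integrable (by norm_num)).const_mul _), integral_const_mul, hi]
      ring)
    have h1 := hu ζ hζ
    rw [hζ', ← inner_toLp 0 hζ.memLp, inner_zero_left, neg_zero] at h1
    have h2 : ∫ x in Ω, u x * (η + (-I) • η₀) x
        = (∫ x in Ω, u x * η x) + (-I) * ∫ x in Ω, u x * η₀ x := by
      rw [← integral_const_mul, ← integral_add (L2.integrable_mul u hη.memLp)
        ((L2.integrable_mul u h₀.memLp).const_mul _)]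
      refine integral_congr_ae (Eventually.of_forall fun x => ?_)
      simp only [Pi.add_apply, Pi.smul_apply, smul_eq_mul]; ring
    rw [h1, ← hC] at h2
    linarith
  exact sub_eq_zero.1 (key.unique IsWeakDeriv.zero)

/-! ### The closure of the test functions in the `H¹` norm -/

theorem norm_sq_toLp {F : ℝ → ℝ} {u : L2} (h : u =ᵐ[μΩ] F) :
    ‖u‖ ^ 2 = ∫ x in Ω, F x ^ 2 := by
  rw [← real_inner_self_eq_norm_sq, L2.inner_def]
  refine integral_congr_ae ?_
  filter_upwards [h] with x hx
  simp [hx, pow_two]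

/-- Poincaré's inequality for test functions, from `∫ (x η²)' = 0` and `|x| ≤ 1`. -/
theorem norm_fst_le_of_mem_testGraph {X : L2 × L2} (hX : X ∈ testGraph) :
    ‖X.1‖ ≤ 2 * ‖X.2‖ := by
  obtain ⟨η, hη, h1, h2⟩ := hX
  have hc := hη.1.continuous
  have hc' := hη.continuous_deriv
  have hi := setIntegral_deriv_eq_zero (F := fun x => x * η x ^ 2)
    (F' := fun x => η x ^ 2 + 2 * x * η x * deriv η x) (fun x => by
      have := (hasDerivAt_id x).mul ((hη.hasDerivAt x).pow 2)
      refine this.congr_deriv ?_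
      simp; ring) (by fun_prop) (by simp [hη.eq_zero]) (by simp [hη.eq_zero])
  have hle : ∫ x in Ω, η x ^ 2 ≤
      ∫ x in Ω, (2 * (η x ^ 2 + 2 * x * η x * deriv η x) + 4 * deriv η x ^ 2) := by
    refine setIntegral_mono_on (integrable_of_continuous (by fun_prop))
      (integrable_of_continuous (by fun_prop)) measurableSet_Ioo fun x hx => ?_
    have hx2 : x ^ 2 ≤ 1 := by nlinarith [hx.1, hx.2]
    nlinarith [sq_nonneg (η x + 2 * x * deriv η x),
      mul_nonneg (sub_nonneg.2 hx2) (sq_nonneg (deriv η x))]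
  rw [integral_add (integrable_of_continuous (by fun_prop))
    (integrable_of_continuous (by fun_prop)), integral_const_mul, integral_const_mul, hi,
    ← norm_sq_toLp h1, ← norm_sq_toLp h2] at hle
  exact abs_le_of_sq_le_sq' (by linarith) (by positivity) |>.2

theorem norm_fst_le_of_mem_closure {X : L2 × L2} (hX : X ∈ testGraph.topologicalClosure) :
    ‖X.1‖ ≤ 2 * ‖X.2‖ :=
  closure_minimal (t := {X : L2 × L2 | ‖X.1‖ ≤ 2 * ‖X.2‖})
    (fun _ h => norm_fst_le_of_mem_testGraph h) (isClosed_le (by fun_prop) (by fun_prop)) hX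

theorem isWeakDeriv_of_mem_closure {X : L2 × L2} (hX : X ∈ testGraph.topologicalClosure) :
    IsWeakDeriv X.1 X.2 := by
  rw [isWeakDeriv_iff_inner]
  intro η hη
  refine closure_minimal (t := {X : L2 × L2 | ⟪X.1, hη.deriv_memLp.toLp (deriv η)⟫_ℝ
    = - ⟪X.2, hη.memLp.toLp η⟫_ℝ}) ?_ (isClosed_eq (by fun_prop) (by fun_prop)) hX
  rintro Y ⟨ζ, hζ, h1, h2⟩
  change ⟪Y.1, _⟫_ℝ = - ⟪Y.2, _⟫_ℝ
  have c1 := hη.1.continuous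
  have c2 := hη.continuous_deriv
  have c3 := hζ.1.continuous
  have c4 := hζ.continuous_deriv
  have e1 : ∫ x in Ω, Y.1 x * deriv η x = ∫ x in Ω, ζ x * deriv η x := by
    refine integral_congr_ae ?_
    filter_upwards [h1] with x hx
    rw [hx]
  have e2 : ∫ x in Ω, Y.2 x * η x = ∫ x in Ω, deriv ζ x * η x := by
    refine integral_congr_ae ?_
    filter_upwards [h2] with x hx
    rw [hx]
  rw [inner_toLp, inner_toLp, e1, e2, eq_neg_iff_add_eq_zero, add_comm,
    ← integral_add (integrable_of_continuous (by fun_prop))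
    (integrable_of_continuous (by fun_prop))]
  exact setIntegral_deriv_eq_zero (F := fun x => ζ x * η x)
    (fun x => (hζ.hasDerivAt x).mul (hη.hasDerivAt x)) (by fun_prop)
    (by simp [hη.eq_zero]) (by simp [hη.eq_zero])

theorem inner_one_add_inner_coord_of_mem_closure {X : L2 × L2}
    (hX : X ∈ testGraph.topologicalClosure) : ⟪X.1, one⟫_ℝ + ⟪X.2, coord⟫_ℝ = 0 := by
  refine closure_minimal (t := {X : L2 × L2 | ⟪X.1, one⟫_ℝ + ⟪X.2, coord⟫_ℝ = 0}) ?_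
    (isClosed_eq (by fun_prop) (by fun_prop)) hX
  rintro Y ⟨ζ, hζ, h1, h2⟩
  change ⟪Y.1, _⟫_ℝ + ⟪Y.2, _⟫_ℝ = 0
  have c3 := hζ.1.continuous
  have c4 := hζ.continuous_deriv
  have e2 : ∫ x in Ω, Y.2 x * id x = ∫ x in Ω, deriv ζ x * x := by
    refine integral_congr_ae ?_
    filter_upwards [h2] with x hx
    rw [hx, id]
  rw [inner_one, coord, inner_toLp, e2, integral_congr_ae h1,
    ← integral_add (integrable_of_continuous (by fun_prop))
    (integrable_of_continuous (by fun_prop))]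
  exact setIntegral_deriv_eq_zero (F := fun x => ζ x * x) (fun x => by
    refine ((hζ.hasDerivAt x).mul (hasDerivAt_id x)).congr_deriv ?_
    simp; ring) (by fun_prop) (by simp [hζ.eq_zero]) (by simp [hζ.eq_zero])

/-- Every function of mean zero is the derivative of an element of the closure: by Poincaré's
inequality the derivatives form a closed subspace, and the functions orthogonal to it have vanishing
weak derivative. -/
theorem exists_mem_closure_of_inner_one_eq_zero {g : L2} (hg : ⟪g, one⟫_ℝ = 0) :
    ∃ w : L2, (w, g) ∈ testGraph.topologicalClosure := by
  let S := testGraph.topologicalClosure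
  have : CompleteSpace S := testGraph.isClosed_topologicalClosure.completeSpace_coe
  let D : S →L[ℝ] L2 := (ContinuousLinearMap.snd ℝ L2 L2).comp S.subtypeL
  have hanti : AntilipschitzWith 2 D := by
    refine ContinuousLinearMap.antilipschitz_of_bound D fun X => ?_
    have h := norm_fst_le_of_mem_closure X.2
    change max ‖(X : L2 × L2).1‖ ‖(X : L2 × L2).2‖ ≤ 2 * ‖(X : L2 × L2).2‖
    exact max_le h (by linarith [norm_nonneg (X : L2 × L2).2])
  have hcl : IsClosed (D.range : Set L2) := by
    have e : (D.range : Set L2) = Set.range D := rfl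
    rw [e]
    exact hanti.isClosed_range D.uniformContinuous
  have : CompleteSpace D.range := hcl.completeSpace_coe
  suffices g ∈ D.range by
    obtain ⟨X, hX⟩ := this
    exact ⟨X.1.1, by
      have : ((X : L2 × L2).1, g) = X := Prod.ext rfl hX.symm
      rw [this]; exact X.2⟩
  rw [← D.range.orthogonal_orthogonal]
  intro q hq
  have hq0 : IsWeakDeriv q 0 := by
    rw [isWeakDeriv_iff_inner]
    intro η hη
    rw [inner_zero_left, neg_zero, real_inner_comm]
    refine hq _ ⟨⟨(hη.memLp.toLp η, hη.deriv_memLp.toLp (deriv η)),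
      testGraph.le_topologicalClosure ⟨η, hη, hη.memLp.coeFn_toLp, hη.deriv_memLp.coeFn_toLp⟩⟩, rfl⟩
  obtain ⟨C, rfl⟩ := hq0.exists_eq_smul_one
  rw [real_inner_smul_left, real_inner_comm, hg, mul_zero]

/-- The two linear conditions express `u(1) = u(-1)` and `u(1) = -u(-1)`, by integration of `u'` and
of `(x u)'`. -/
theorem mem_H10_of_inner_eq_zero {u : L2} (hu : u ∈ H1) (h1 : ⟪weakDeriv u, one⟫_ℝ = 0)
    (h2 : ⟪u, one⟫_ℝ + ⟪weakDeriv u, coord⟫_ℝ = 0) : u ∈ H10 := by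
  obtain ⟨w, hw⟩ := exists_mem_closure_of_inner_one_eq_zero h1
  have hd : IsWeakDeriv (u - w) 0 := by
    have := (isWeakDeriv_weakDeriv hu).add ((isWeakDeriv_of_mem_closure hw).smul (-1))
    simpa [sub_eq_add_neg] using this
  obtain ⟨C, hC⟩ := hd.exists_eq_smul_one
  have h3 := inner_one_add_inner_coord_of_mem_closure hw
  have h4 : C * ⟪one, one⟫_ℝ = 0 := by
    rw [← real_inner_smul_left, ← hC, inner_sub_left]
    change ⟪w, one⟫_ℝ + ⟪weakDeriv u, coord⟫_ℝ = 0 at h3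
    linarith
  have hC0 : C = 0 := (mul_eq_zero.1 h4).resolve_right (inner_self_ne_zero.2 one_ne_zero)
  rw [hC0, zero_smul, sub_eq_zero] at hC
  exact ⟨hu, by rw [hC] at hw ⊢; exact hw⟩

/-! ### The space `𝒲₀` is nontrivial -/

theorem exists_linearIndependent_L2 (n : ℕ) : ∃ e : Fin n → L2, LinearIndependent ℝ e := by
  let s : Fin n → Set ℝ := fun i => Set.Ioo ((i : ℝ) / n) (((i : ℝ) + 1) / n)
  have hms : ∀ i, MeasurableSet (s i) := fun i => measurableSet_Ioo
  have hfin : ∀ i, μΩ (s i) ≠ ⊤ := fun i => measure_ne_top _ _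
  refine ⟨fun i => indicatorConstLp 2 (hms i) (hfin i) (1 : ℝ),
    linearIndependent_of_ne_zero_of_inner_eq_zero (𝕜 := ℝ) (fun i h => ?_) fun i j hij => ?_⟩
  · have hn : (0 : ℝ) < n := by exact_mod_cast i.pos
    have hsub : s i ⊆ Ω := fun x hx => by
      have h1 : ((i : ℝ) + 1) / n ≤ 1 := by
        rw [div_le_one hn]; exact_mod_cast i.isLt
      have h2 : 0 ≤ (i : ℝ) / n := by positivity
      exact ⟨by linarith [hx.1], by linarith [hx.2]⟩
    have h0 : μΩ (s i) = 0 := by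
      have := norm_indicatorConstLp (p := 2) (hs := hms i) (hμs := hfin i) (c := (1 : ℝ))
        (by norm_num) (by norm_num)
      rw [h, norm_zero] at this
      have h' : μΩ.real (s i) = 0 := by
        by_contra hne
        have : 0 < μΩ.real (s i) ^ (1 / (2 : ℝ≥0∞).toReal) :=
          Real.rpow_pos_of_pos (lt_of_le_of_ne measureReal_nonneg (Ne.symm hne)) _
        simp_all
      exact (measureReal_eq_zero_iff (hfin i)).1 h'
    rw [Measure.restrict_apply (hms i), Set.inter_eq_left.2 hsub, Real.volume_Ioo,
      ENNReal.ofReal_eq_zero, ← sub_div, add_sub_cancel_left] at h0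
    have : 0 < 1 / (n : ℝ) := by positivity
    linarith
  · have hd : ∀ i j : Fin n, (i : ℕ) < j → Disjoint (s i) (s j) := fun i j h => by
      refine Set.disjoint_left.2 fun x hx hx' => ?_
      have : ((i : ℝ) + 1) / n ≤ (j : ℝ) / n := by
        gcongr; exact_mod_cast h
      linarith [hx.2, hx'.1]
    have hdij : Disjoint (s i) (s j) := by
      rcases lt_or_gt_of_ne (Fin.val_ne_of_ne hij) with h | h
      exacts [hd i j h, (hd j i h).symm]
    change ⟪indicatorConstLp 2 (hms i) (hfin i) (1 : ℝ),
      indicatorConstLp 2 (hms j) (hfin j) (1 : ℝ)⟫_ℝ = 0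
    rw [L2.inner_def]
    refine integral_eq_zero_of_ae ?_
    filter_upwards [indicatorConstLp_coeFn (p := 2) (hs := hms i) (hμs := hfin i) (c := (1 : ℝ)),
      indicatorConstLp_coeFn (p := 2) (hs := hms j) (hμs := hfin j) (c := (1 : ℝ))] with x hi hj
    rw [hi, hj]
    by_cases hx : x ∈ s i
    · simp [Set.disjoint_left.1 hdij hx]
    · simp [hx]

/-- `𝒲₀` is the kernel of two linear functionals on an infinite-dimensional space. -/
theorem Preconditioner.exists_mem_W0_ne_zero (P : Preconditioner) : ∃ φ ∈ P.W0, φ ≠ 0 := by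
  let Λ : L2 →ₗ[ℝ] ℝ × ℝ :=
    { toFun := fun φ => (⟪P.DR φ, one⟫_ℝ, ⟪P.R φ, one⟫_ℝ + ⟪P.DR φ, coord⟫_ℝ)
      map_add' := fun φ ψ => by
        simp only [map_add, inner_add_left, Prod.mk_add_mk]
        congr 1; ring
      map_smul' := fun t φ => by
        simp only [map_smul, real_inner_smul_left, RingHom.id_apply, Prod.smul_mk, smul_eq_mul]
        congr 1; ring }
  obtain ⟨e, he⟩ := exists_linearIndependent_L2 3
  have hker : LinearMap.ker Λ ≠ ⊥ := by
    intro hk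
    have := (he.map' Λ hk).fintype_card_le_finrank
    simp at this
  obtain ⟨φ, hφ, hne⟩ := Submodule.exists_mem_ne_zero_of_ne_bot hker
  have h := Prod.ext_iff.1 (LinearMap.mem_ker.1 hφ)
  exact ⟨φ, mem_H10_of_inner_eq_zero (P.map_L2 φ) h.1 h.2, hne⟩

/-! ### Positivity of the bilinear form -/

theorem inner_mulOp (a : Linf) (g : L2) : ⟪mulOp a g, g⟫_ℝ = ∫ x in Ω, mulOp a g x * g x := by
  rw [L2.inner_def]
  exact integral_congr_ae (Eventually.of_forall fun x => by simp [mul_comm])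

theorem mul_norm_sq_le_inner_mulOp {a : Linf} {t : ℝ} (ha : ∀ᵐ x ∂μΩ, t ≤ a x) (g : L2) :
    t * ‖g‖ ^ 2 ≤ ⟪mulOp a g, g⟫_ℝ := by
  rw [norm_sq_toLp EventuallyEq.rfl, inner_mulOp, ← integral_const_mul]
  refine integral_mono_ae ((Lp.memLp g).integrable_sq.const_mul t)
    (L2.integrable_mul _ (Lp.memLp g)) ?_
  filter_upwards [ha, mulOp_coeFn a g] with x hx h
  rw [h]
  nlinarith [mul_nonneg (sub_nonneg.2 hx) (sq_nonneg (g x))]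

theorem inner_mulOp_nonneg {a : Linf} (ha : ∀ᵐ x ∂μΩ, 0 ≤ a x) (g : L2) :
    0 ≤ ⟪mulOp a g, g⟫_ℝ := by
  simpa using mul_norm_sq_le_inner_mulOp ha g

theorem eq_zero_of_inner_mulOp_eq_zero {a : Linf} (ha : ∀ᵐ x ∂μΩ, 0 < a x) {g : L2}
    (hg : ⟪mulOp a g, g⟫_ℝ = 0) : g = 0 := by
  have h0 : 0 ≤ᵐ[μΩ] fun x => mulOp a g x * g x := by
    filter_upwards [ha, mulOp_coeFn a g] with x hx h
    rw [h]
    change 0 ≤ a x * g x * g x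
    nlinarith [mul_nonneg hx.le (sq_nonneg (g x))]
  rw [inner_mulOp, integral_eq_zero_iff_of_nonneg_ae h0 (L2.integrable_mul _ (Lp.memLp g))] at hg
  refine Lp.ext ?_
  filter_upwards [ha, mulOp_coeFn a g, hg, Lp.coeFn_zero ℝ 2 μΩ] with x hx h h1 h2
  rw [h2]
  rw [h] at h1
  simpa [hx.ne'] using h1

theorem bform_comm (a c : Linf) (u w : L2) : bform a c u w = bform a c w u :=
  integral_congr_ae (Eventually.of_forall fun x => by ring)

namespace Preconditioner

variable (P : Preconditioner)

theorem T_isSymmetric (a c : Linf) : (P.T a c : L2 →ₗ[ℝ] L2).IsSymmetric := fun φ ψ => by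
  change ⟪P.T a c φ, ψ⟫_ℝ = ⟪φ, P.T a c ψ⟫_ℝ
  rw [real_inner_comm (P.T a c ψ) φ, inner_T, inner_T, bform_comm]

theorem T_nonneg {a c : Linf} (ha : ∀ᵐ x ∂μΩ, 0 ≤ a x) (hc : ∀ᵐ x ∂μΩ, 0 ≤ c x) (φ : L2) :
    0 ≤ ⟪P.T a c φ, φ⟫_ℝ := by
  rw [inner_T, bform_eq]
  exact add_nonneg (inner_mulOp_nonneg ha _) (inner_mulOp_nonneg hc _)

theorem T_mem_W0 (a c : Linf) (φ : L2) : P.T a c φ ∈ P.W0 := by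
  have h : ContinuousLinearMap.adjoint P.proj = P.proj :=
    (isSelfAdjoint_starProjection P.W0).adjoint_eq
  rw [T, h]
  exact P.proj_mem _

theorem T_pos {a c : Linf} (ha : ∀ᵐ x ∂μΩ, 0 < a x) (hc : ∀ᵐ x ∂μΩ, 0 ≤ c x) {φ : L2}
    (hφ : φ ∈ P.W0) (h0 : φ ≠ 0) : 0 < ⟪P.T a c φ, φ⟫_ℝ := by
  have ha' : ∀ᵐ x ∂μΩ, 0 ≤ a x := ha.mono fun x hx => hx.le
  refine lt_of_le_of_ne (P.T_nonneg ha' hc φ) fun h => h0 ?_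
  rw [P.inner_T_self a c hφ, bform_eq] at h
  have h1 := inner_mulOp_nonneg ha' (weakDeriv (P.R φ))
  have h2 := inner_mulOp_nonneg hc (P.R φ)
  have hd := eq_zero_of_inner_mulOp_eq_zero ha (le_antisymm (by linarith) h1)
  obtain ⟨γ₀, γ₁, hγ, -, hb⟩ := P.laplacian
  have := (hb φ).1
  rw [hd, norm_zero] at this
  have h3 : ‖φ‖ ^ 2 ≤ 0 := nonpos_of_mul_nonpos_right (by simpa using this) hγ
  simpa using le_antisymm h3 (sq_nonneg _)

theorem mul_norm_sq_le_inner_T {a c : Linf} {a₀ : ℝ} (ha : ∀ᵐ x ∂μΩ, a₀ ≤ a x) (ha₀ : 0 < a₀)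
    (hc : ∀ᵐ x ∂μΩ, 0 ≤ c x) : ∃ t, 0 < t ∧ ∀ φ ∈ P.W0, t * ‖φ‖ ^ 2 ≤ ⟪P.T a c φ, φ⟫_ℝ := by
  obtain ⟨γ₀, γ₁, hγ, -, hb⟩ := P.laplacian
  refine ⟨a₀ * γ₀, mul_pos ha₀ hγ, fun φ hφ => ?_⟩
  rw [P.inner_T_self a c hφ, bform_eq]
  have h1 := mul_norm_sq_le_inner_mulOp ha (weakDeriv (P.R φ))
  have h2 := inner_mulOp_nonneg hc (P.R φ)
  nlinarith [mul_le_mul_of_nonneg_left (hb φ).1 ha₀.le]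

/-! ### The condition number -/

/-- The condition number is `M / m` for the optimal bounds `m ≤ 𝒯 ≤ M` on `𝒲₀`. The supremum
is positive because `𝒲₀` is nontrivial; the infimum may vanish. -/
theorem exists_condNumber_eq {a c : Linf} (ha : ∀ᵐ x ∂μΩ, 0 < a x) (hc : ∀ᵐ x ∂μΩ, 0 ≤ c x) :
    ∃ m M : ℝ, 0 ≤ m ∧ 0 < M ∧ m ≤ M ∧ (∀ φ ∈ P.W0, m * ‖φ‖ ^ 2 ≤ ⟪P.T a c φ, φ⟫_ℝ) ∧
      (∀ φ ∈ P.W0, ⟪P.T a c φ, φ⟫_ℝ ≤ M * ‖φ‖ ^ 2) ∧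
      (∀ t, (∀ φ ∈ P.W0, t * ‖φ‖ ^ 2 ≤ ⟪P.T a c φ, φ⟫_ℝ) → t ≤ m) ∧
      P.condNumber a c = ENNReal.ofReal M / ENNReal.ofReal m := by
  set S : Set L2 := {φ : L2 | φ ∈ P.W0 ∧ ‖φ‖ = 1} with hS
  set s := ⨆ φ ∈ S, ENNReal.ofReal ⟪P.T a c φ, φ⟫_ℝ with hs
  set i := ⨅ φ ∈ S, ENNReal.ofReal ⟪P.T a c φ, φ⟫_ℝ with hi
  obtain ⟨φ₀, h₀, hne⟩ := P.exists_mem_W0_ne_zero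
  have normalize : ∀ φ ∈ P.W0, φ ≠ 0 → ‖φ‖⁻¹ • φ ∈ S ∧
      ⟪P.T a c φ, φ⟫_ℝ = ⟪P.T a c (‖φ‖⁻¹ • φ), ‖φ‖⁻¹ • φ⟫_ℝ * ‖φ‖ ^ 2 := by
    intro φ hφ h
    have hn : ‖φ‖ ≠ 0 := norm_ne_zero_iff.2 h
    refine ⟨⟨P.W0.smul_mem _ hφ, norm_smul_inv_norm h⟩, ?_⟩
    rw [map_smul, real_inner_smul_left, real_inner_smul_right]
    field_simp
  have hle : ∀ φ ∈ S, ENNReal.ofReal ⟪P.T a c φ, φ⟫_ℝ ≤ s := fun φ hφ =>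
    le_iSup₂ (f := fun φ (_ : φ ∈ S) => ENNReal.ofReal ⟪P.T a c φ, φ⟫_ℝ) φ hφ
  have hge : ∀ φ ∈ S, i ≤ ENNReal.ofReal ⟪P.T a c φ, φ⟫_ℝ := fun φ hφ =>
    iInf₂_le (f := fun φ (_ : φ ∈ S) => ENNReal.ofReal ⟪P.T a c φ, φ⟫_ℝ) φ hφ
  have hs_top : s ≠ ⊤ := by
    refine ne_top_of_le_ne_top ENNReal.ofReal_ne_top (iSup₂_le fun φ hφ =>
      ENNReal.ofReal_le_ofReal (q := ‖P.T a c‖) ?_)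
    calc ⟪P.T a c φ, φ⟫_ℝ ≤ ‖P.T a c φ‖ * ‖φ‖ := real_inner_le_norm _ _
      _ ≤ ‖P.T a c‖ := by
        rw [hφ.2, mul_one]
        simpa [hφ.2] using (P.T a c).le_opNorm φ
  obtain ⟨hS₀, -⟩ := normalize φ₀ h₀ hne
  have his : i ≤ s := (hge _ hS₀).trans (hle _ hS₀)
  have hi_top : i ≠ ⊤ := ne_top_of_le_ne_top hs_top his
  have hs_pos : 0 < s := by
    refine lt_of_lt_of_le (ENNReal.ofReal_pos.2 (P.T_pos ha hc hS₀.1 ?_)) (hle _ hS₀)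
    intro h
    have := hS₀.2
    rw [h, norm_zero] at this
    exact zero_ne_one this
  refine ⟨i.toReal, s.toReal, ENNReal.toReal_nonneg, ENNReal.toReal_pos hs_pos.ne' hs_top,
    ENNReal.toReal_mono hs_top his, fun φ hφ => ?_, fun φ hφ => ?_, fun t ht => ?_, ?_⟩
  · rcases eq_or_ne φ 0 with rfl | h
    · simp
    · obtain ⟨h1, h2⟩ := normalize φ hφ h
      rw [h2]
      refine mul_le_mul_of_nonneg_right ?_ (sq_nonneg _)
      exact ENNReal.toReal_le_of_le_ofReal
        (P.T_nonneg (ha.mono fun x hx => hx.le) hc _) (hge _ h1)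
  · rcases eq_or_ne φ 0 with rfl | h
    · simp
    · obtain ⟨h1, h2⟩ := normalize φ hφ h
      rw [h2]
      refine mul_le_mul_of_nonneg_right ?_ (sq_nonneg _)
      exact (ENNReal.ofReal_le_iff_le_toReal hs_top).1 (hle _ h1)
  · rw [← ENNReal.ofReal_le_iff_le_toReal hi_top]
    refine le_iInf₂ fun φ hφ => ENNReal.ofReal_le_ofReal ?_
    simpa [hφ.2] using ht φ hφ.1
  · rw [ENNReal.ofReal_toReal hs_top, ENNReal.ofReal_toReal hi_top]
    rfl

end Preconditioner

theorem cgFactor_div {m M : ℝ} (hm : 0 ≤ m) (hM : 0 < M) :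
    cgFactor (ENNReal.ofReal M / ENNReal.ofReal m) = (√M - √m) / (√M + √m) := by
  have hsM : 0 < √M := Real.sqrt_pos.2 hM
  rcases hm.eq_or_lt with rfl | hm
  · rw [cgFactor, ENNReal.ofReal_zero, ENNReal.div_zero (ENNReal.ofReal_pos.2 hM).ne', if_pos rfl]
    simp [hsM.ne']
  · have hsm : 0 < √m := Real.sqrt_pos.2 hm
    rw [← ENNReal.ofReal_div_of_pos hm, cgFactor, if_neg ENNReal.ofReal_ne_top,
      ENNReal.toReal_ofReal (by positivity), Real.sqrt_div hM.le]
    field_simp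

/-! ### Convergence of the preconditioned method -/

/-- On `𝒲₀` the preconditioned method is the conjugate gradient method for `𝒯`. -/
theorem isCG_cgState (P : Preconditioner) (a c : Linf) {f : L2}
    (hf : ContinuousLinearMap.adjoint P.R f ∈ P.W0) :
    IsCG (P.T a c : L2 →ₗ[ℝ] L2) (ContinuousLinearMap.adjoint P.R f)
      (fun k => (cgState P a c f k).v) (fun k => (cgState P a c f k).r)
      (fun k => (cgState P a c f k).p) := by
  have hmem : ∀ k, (cgState P a c f k).r ∈ P.W0 ∧ (cgState P a c f k).p ∈ P.W0 := by
    intro k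
    induction k with
    | zero => exact ⟨hf, hf⟩
    | succ k ih =>
      have h : (cgState P a c f (k + 1)).r ∈ P.W0 :=
        P.W0.sub_mem ih.1 (P.W0.smul_mem _ (P.T_mem_W0 a c _))
      exact ⟨h, P.W0.add_mem h (P.W0.smul_mem _ ih.2)⟩
  refine ⟨rfl, rfl, rfl, fun k => ?_, fun k => ?_, fun k => rfl⟩
  · change _ = _ + (_ / ⟪P.T a c _, _⟫_ℝ) • _
    rw [P.inner_T_self a c (hmem k).2]
    rfl
  · change _ = _ - (_ / ⟪P.T a c _, _⟫_ℝ) • _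
    rw [P.inner_T_self a c (hmem k).2]
    rfl

theorem T_apply_of_isSolution (P : Preconditioner) {a c : Linf} {f v : L2}
    (hf : ContinuousLinearMap.adjoint P.R f ∈ P.W0) (hv : IsSolution a c f (P.R v)) :
    P.T a c v = ContinuousLinearMap.adjoint P.R f := by
  have hvW : P.proj v = v := Submodule.starProjection_eq_self_iff.2 hv.1
  have hfW : P.proj (ContinuousLinearMap.adjoint P.R f) = ContinuousLinearMap.adjoint P.R f :=
    Submodule.starProjection_eq_self_iff.2 hf
  have hadj : ContinuousLinearMap.adjoint P.proj = P.proj :=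
    (isSelfAdjoint_starProjection P.W0).adjoint_eq
  refine ext_inner_right ℝ fun ψ => ?_
  have hB : bform a c (P.R v) (P.R (P.proj ψ)) = ⟪f, P.R (P.proj ψ)⟫_ℝ := hv.2 _ (P.proj_mem ψ)
  rw [P.inner_T, hvW, hB, ← ContinuousLinearMap.adjoint_inner_left,
    ← ContinuousLinearMap.adjoint_inner_left, hadj, hfW]

end OperatorCG
end

theorem mainTheorem1 (a c : OperatorCG.Linf)
    (ha : ∀ᵐ x ∂OperatorCG.μΩ, 0 < a x) (hc : ∀ᵐ x ∂OperatorCG.μΩ, 0 ≤ c x)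
    (P : OperatorCG.Preconditioner) (f u : OperatorCG.L2)
    (hf : ContinuousLinearMap.adjoint P.R f ∈ P.W0)
    (hu : OperatorCG.IsSolution a c f u) (huR : ∃ v, u = P.R v) :
    (∀ k : ℕ, OperatorCG.energyNorm a c (u - OperatorCG.cgIterate P a c f k) ≤
      2 * OperatorCG.cgFactor (P.condNumber a c) ^ k * OperatorCG.energyNorm a c u) ∧
    ((∃ a₀ : ℝ, 0 < a₀ ∧ ∀ᵐ x ∂OperatorCG.μΩ, a₀ ≤ a x) →
      1 ≤ P.condNumber a c ∧ P.condNumber a c < ⊤ ∧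
      0 ≤ OperatorCG.cgFactor (P.condNumber a c) ∧ OperatorCG.cgFactor (P.condNumber a c) < 1) := by
  obtain ⟨v, rfl⟩ := huR
  obtain ⟨m, M, hm, hM, hmM, hlow, hup, hopt, hκ⟩ := P.exists_condNumber_eq ha hc
  rw [hκ, OperatorCG.cgFactor_div hm hM]
  constructor
  · intro k
    have hcg := OperatorCG.isCG_cgState P a c hf
    have hW : ∀ z ∈ P.W0, (P.T a c : OperatorCG.L2 →ₗ[ℝ] OperatorCG.L2) z ∈ P.W0 :=
      fun z _ => P.T_mem_W0 a c z
    have hvW : v ∈ P.W0 := hu.1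
    have h := hcg.sqrt_inner_error_le (P.T_isSymmetric a c)
      (P.T_nonneg (ha.mono fun x hx => hx.le) hc) (OperatorCG.T_apply_of_isSolution P hf hu)
      hW hvW hm hM hmM hlow hup k
    have hmem := (hcg.mem hW hf k).1
    simp only [ContinuousLinearMap.coe_coe] at h hmem
    rw [P.inner_T_self a c hvW, P.inner_T_self a c (P.W0.sub_mem hvW hmem), map_sub] at h
    exact h
  · rintro ⟨a₀, ha₀, ha₀'⟩
    obtain ⟨t, ht, htW⟩ := P.mul_norm_sq_le_inner_T ha₀' ha₀ hc
    have hm0 : 0 < m := ht.trans_le (hopt t htW)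
    have hsM : 0 < √M := Real.sqrt_pos.2 hM
    have hsm : 0 < √m := Real.sqrt_pos.2 hm0
    rw [← ENNReal.ofReal_div_of_pos hm0]
    refine ⟨?_, ENNReal.ofReal_lt_top, ?_, ?_⟩
    · rw [← ENNReal.ofReal_one]
      exact ENNReal.ofReal_le_ofReal ((one_le_div hm0).2 hmM)
    · exact div_nonneg (sub_nonneg.2 (Real.sqrt_le_sqrt hmM)) (by positivity)
    · rw [div_lt_one (by positivity)]
      linarith
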